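/- Let $E=\mathbb{R}\times\{-1,+1\}$, let $a>0$ and let $\lambda:E\to[0,\infty)$ be continuous; write $\lambda^{\pm}(y)=\lambda(y,\pm1)$. Suppose there are constants $y_0\ge 0$ and $\lambda_{\min}>0$ such that $\lambda(y,j)\ge\lambda_{\min}$ and $\lambda(y,-j)\le\lambda(y,j)$ whenever $jy\ge y_0$. The zig-zag process $(Y,J)$ with speed $a$ and switching rate $\lambda$ started in $(y,j)\in E$ is defined as follows: $T_0=0$, $(Y(0),J(0))=(y,j)$, and for $i\ge1$ the waiting time $Z_i$ has conditional law $\mathbb{P}_{y,j}(Z_i>t\mid Z_1,\dots,Z_{i-1})=F(t;Y(T_{i-1}),J(T_{i-1}))$, $t\ge0$, where $F(t;y,j)=\exp\left(-\int_0^t\lambda(y+ajs,j)\,ds\right)$; $T_i=T_{i-1}+Z_i$; $Y(t)=Y(T_{i-1})+aJ(T_{i-1})(t-T_{i-1})$ for $T_{i-1}<t\le T_i$; $J(t)=J(T_{i-1})$ for $T_{i-1}<t<T_i$, and $J(T_i)=-J(T_{i-1})$. Define $$\Psi(y)=\frac1a\int_0^y\{\lambda^+(\eta)-\lambda^-(\eta)\}\,d\eta,\qquad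 y\in\mathbb{R}.$$ Then $\Psi$ is finite everywhere and bounded from below. Moreover, from every starting point the zig-zag process exists and is almost surely non-explosive ($T_k\to\infty$), its transition probabilities $P_t((y,j),\cdot)=\mathbb{P}_{y,j}((Y(t),J(t))\in\cdot)$ are uniquely determined Markov kernels on $E$, and the measure $\mu$ on $E$ with density $(y,j)\mapsto\exp(-\Psi(y))$ with respect to $\mathrm{Leb}\otimes(\delta_{-1}+\delta_{+1})$ (which may be infinite) is invariant: $\int_E P_t(x,A)\,\mu(dx)=\mu(A)$ for all Borel $A\subseteq E$ and all $t\ge0$. -/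

import Mathlib

open MeasureTheory ProbabilityTheory Filter
open scoped NNReal ENNReal

universe u

namespace ZigZag

/-- The velocity space `{-1, +1}`, realised as the units of `ℤ`, has the discrete σ-algebra. -/
instance instDiscreteMeasurableSpaceSign : DiscreteMeasurableSpace ℤˣ :=
  ⟨fun s => ⟨Units.val '' s, MeasurableSet.of_discrete,
    Set.preimage_image_eq s Units.val_injective⟩⟩

/-- The state space `E = ℝ × {-1, +1}`; a state is a pair (position, direction). -/
abbrev State : Type := ℝ × ℤˣ

noncomputable section

/-- Position at time `s` of a particle that starts in `x.1` and moves with constant velocity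
`a * x.2`. -/
def drift (a : ℝ) (x : State) (s : ℝ) : ℝ := x.1 + a * ((x.2 : ℤ) : ℝ) * s

/-- The survival function `F(t; y, j) = exp (-∫₀ᵗ λ(y + a j s, j) ds)`. -/
def survival (a : ℝ) (lam : State → ℝ) (x : State) (t : ℝ) : ℝ :=
  Real.exp (-∫ s in (0 : ℝ)..t, lam (drift a x s, x.2))

/-- `skeleton a x z k` is the state `(Y(T_k), J(T_k))` immediately after the `k`-th switch, for
the path started in `x` with successive waiting times `z 0, z 1, …`. -/
def skeleton (a : ℝ) (x : State) (z : ℕ → ℝ) : ℕ → State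
  | 0 => x
  | k + 1 => (drift a (skeleton a x z k) (z k), -(skeleton a x z k).2)

/-- The time `T_k` of the `k`-th switch: the sum of the first `k` waiting times; `T_0 = 0`. -/
def switchTime (z : ℕ → ℝ) (k : ℕ) : ℝ := ∑ i ∈ Finset.range k, z i

/-- The number of switches up to time `t`, `N(t) = sup {k | T_k ≤ t}`. -/
def numSwitches (z : ℕ → ℝ) (t : ℝ) : ℕ := sSup {k : ℕ | switchTime z k ≤ t}

/-- The state `(Y(t), J(t))` at time `t` of the path started in `x` with waiting times `z`. -/
def path (a : ℝ) (x : State) (z : ℕ → ℝ) (t : ℝ) : State :=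
  let k := numSwitches z t
  (drift a (skeleton a x z k) (t - switchTime z k), (skeleton a x z k).2)

/-- The random variables `Z 0, Z 1, …` on the probability space `(Ω, Q)` are the successive
waiting times of a zig-zag process with speed `a` and switching rate `lam` started in `x`: given
the previous ones, `Z i` has survival function `F(·; Y(T_i), J(T_i))`. (The numbering starts
at `0`, so `Z i` is the time between the `i`-th and the `(i+1)`-st switch.) The process itself is
`t ↦ path a x (fun k => Z k ω) t`. -/
structure IsZigZag (a : ℝ) (lam : State → ℝ) (x : State) {Ω : Type*} [MeasurableSpace Ω]
    (Q : Measure Ω) (Z : ℕ → Ω → ℝ) : Prop where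
  measurable : ∀ i, Measurable (Z i)
  cond_survival : ∀ (i : ℕ) (t : ℝ), 0 ≤ t →
    Q⟦{ω | t < Z i ω} |
        MeasurableSpace.comap (fun ω (k : Fin i) => Z k ω) MeasurableSpace.pi⟧
      =ᵐ[Q] fun ω => survival a lam (skeleton a x (fun k => Z k ω) i) t

/-- `P` is the transition function of the zig-zag process with speed `a` and rate `lam`: from
every starting point the process exists, and each of its realisations is almost surely
non-explosive and has law `P t x` at time `t`. In particular `P` is unique. -/
structure IsTransitionFunction (a : ℝ) (lam : State → ℝ) (P : ℝ≥0 → Kernel State State) :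
    Prop where
  markov : ∀ t, IsMarkovKernel (P t)
  exists_process : ∀ x : State, ∃ (Ω : Type) (_ : MeasurableSpace Ω) (Q : Measure Ω)
    (Z : ℕ → Ω → ℝ), IsProbabilityMeasure Q ∧ IsZigZag a lam x Q Z
  non_explosive : ∀ (x : State) (Ω : Type u) [MeasurableSpace Ω] (Q : Measure Ω)
    [IsProbabilityMeasure Q] (Z : ℕ → Ω → ℝ), IsZigZag a lam x Q Z →
      ∀ᵐ ω ∂Q, Tendsto (switchTime fun k => Z k ω) atTop atTop
  law : ∀ (x : State) (Ω : Type u) [MeasurableSpace Ω] (Q : Measure Ω)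
    [IsProbabilityMeasure Q] (Z : ℕ → Ω → ℝ), IsZigZag a lam x Q Z →
      ∀ t : ℝ≥0, Q.map (fun ω => path a x (fun k => Z k ω) t) = P t x

/-- There are `y₀ ≥ 0` and `λ_min > 0` such that `λ(y, j) ≥ λ_min` and `λ(y, -j) ≤ λ(y, j)`
whenever `j y ≥ y₀`. -/
def RateAssumption (lam : State → ℝ) : Prop :=
  ∃ y₀ lmin : ℝ, 0 ≤ y₀ ∧ 0 < lmin ∧
    (∀ (y : ℝ) (j : ℤˣ), y₀ ≤ ((j : ℤ) : ℝ) * y → lmin ≤ lam (y, j)) ∧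
    (∀ (y : ℝ) (j : ℤˣ), y₀ ≤ ((j : ℤ) : ℝ) * y → lam (y, -j) ≤ lam (y, j))

/-- `Ψ(y) = (1/a) ∫₀ʸ (λ⁺(η) - λ⁻(η)) dη`. -/
def potential (a : ℝ) (lam : State → ℝ) (y : ℝ) : ℝ :=
  1 / a * ∫ η in (0 : ℝ)..y, (lam (η, 1) - lam (η, -1))

/-- The measure with density `(y, j) ↦ exp (-Ψ(y))` with respect to the product of Lebesgue
measure on `ℝ` and counting measure on `{-1, +1}`. -/
def invMeasure (a : ℝ) (lam : State → ℝ) : Measure State :=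
  ((volume : Measure ℝ).prod (Measure.count : Measure ℤˣ)).withDensity
    fun x => ENNReal.ofReal (Real.exp (-potential a lam x.1))

end

end ZigZag

/-!
Expand the law of `(Y(t), J(t))` in the number of switches up to time `t`, the Dyson–Phillips
expansion of the semigroup: the `n`-th term alternates `n + 1` pieces of the motion killed at rate
`λ` with `n` reversals of direction at rate `λ`. Since `a Ψ' = λ⁺ - λ⁻`, both the killed motion and
the reversals are self-adjoint with respect to `exp (-Ψ)`, up to reversing the direction of motion.
Taking adjoints reads the `n`-th term backwards in time, which exchanges the first switch with the
last one and so gives the `n`-th term again; hence the full semigroup is self-adjoint up to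
reversal of the direction. As it preserves the constant function `1`, it preserves the measure.

If the times of the switches stayed bounded, the path would stay in a compact set, where a waiting
time exceeds `1` with a conditional probability bounded away from `0`. By Lévy's extension of the
Borel–Cantelli lemma infinitely many waiting times would then exceed `1`, which is absurd; so the
process does not explode.
-/

namespace ZigZag

noncomputable section

variable {a : ℝ} {lam : State → ℝ}

/-! ### The free motion, the waiting time and the potential -/

/-- The free motion: the state at time `s` of a particle started in `x` that never switches. -/
def flow (a : ℝ) (x : State) (s : ℝ) : State := (drift a x s, x.2)

/-- The involution of the state space that reverses the direction of motion. -/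
def reverse (x : State) : State := (x.1, -x.2)

@[simp]
lemma reverse_reverse (x : State) : reverse (reverse x) = x := by
  simp [reverse]

lemma flow_reverse_flow (x : State) (t s : ℝ) :
    flow a (reverse (flow a x t)) s = reverse (flow a x (t - s)) := by
  ext
  · simp only [flow, reverse, drift, Units.val_neg, Int.cast_neg]
    ring
  · rfl

lemma flow_zero (x : State) : flow a x 0 = x := by
  simp [flow, drift]

lemma abs_sign (j : ℤˣ) : |((j : ℤ) : ℝ)| = 1 := by
  rcases Int.units_eq_one_or j with rfl | rfl <;> simp

lemma continuous_flow : Continuous fun p : State × ℝ => flow a p.1 p.2 := by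
  have hsign : Continuous fun p : State × ℝ => ((p.1.2 : ℤ) : ℝ) :=
    (continuous_of_discreteTopology (f := fun j : ℤˣ => ((j : ℤ) : ℝ))).comp (by fun_prop)
  unfold flow drift
  fun_prop

lemma continuous_flow_right (x : State) : Continuous (flow a x) :=
  continuous_flow.comp (Continuous.prodMk_right x)

lemma continuous_reverse : Continuous reverse :=
  continuous_fst.prodMk (continuous_of_discreteTopology.comp continuous_snd)

@[fun_prop]
lemma measurable_reverse : Measurable reverse :=
  continuous_reverse.measurable

@[fun_prop]
lemma measurable_flow : Measurable fun p : State × ℝ => flow a p.1 p.2 :=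
  continuous_flow.measurable

lemma survival_pos (x : State) (t : ℝ) : 0 < survival a lam x t := Real.exp_pos _

lemma survival_zero (x : State) : survival a lam x 0 = 1 := by simp [survival]

lemma continuous_survival (hcont : Continuous lam) :
    Continuous fun p : State × ℝ => survival a lam p.1 p.2 := by
  refine Real.continuous_exp.comp (Continuous.neg ?_)
  refine intervalIntegral.continuous_parametric_intervalIntegral_of_continuous
    (f := fun (p : State × ℝ) s => lam (flow a p.1 s)) ?_ continuous_snd
  exact hcont.comp (continuous_flow.comp
    (by fun_prop : Continuous fun q : (State × ℝ) × ℝ => (q.1.1, q.2)))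

lemma hasDerivAt_survival (hcont : Continuous lam) (x : State) (t : ℝ) :
    HasDerivAt (survival a lam x) (-(lam (flow a x t) * survival a lam x t)) t := by
  have hrate : Continuous fun s => lam (flow a x s) := hcont.comp (continuous_flow_right x)
  refine (hrate.integral_hasStrictDerivAt 0 t).hasDerivAt.neg.exp.congr_deriv ?_
  change survival a lam x t * _ = _
  ring

lemma le_sign_mul_drift {y₀ : ℝ} (ha : 0 < a) (x : State) {s : ℝ} (hs : (y₀ + |x.1|) / a ≤ s) :
    y₀ ≤ ((x.2 : ℤ) : ℝ) * drift a x s := by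
  have hsign : ((x.2 : ℤ) : ℝ) * drift a x s = ((x.2 : ℤ) : ℝ) * x.1 + s * a := by
    rcases Int.units_eq_one_or x.2 with h | h <;> simp [drift, h] <;> ring
  have hstart : -|x.1| ≤ ((x.2 : ℤ) : ℝ) * x.1 := by
    simpa only [abs_mul, abs_sign, one_mul] using neg_abs_le (((x.2 : ℤ) : ℝ) * x.1)
  rw [div_le_iff₀ ha] at hs
  linarith

lemma tendsto_survival_of_le_rate {y₀ lmin : ℝ} (ha : 0 < a) (hcont : Continuous lam)
    (hmin : 0 < lmin)
    (hlow : ∀ (y : ℝ) (j : ℤˣ), y₀ ≤ ((j : ℤ) : ℝ) * y → lmin ≤ lam (y, j)) (x : State) :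
    Tendsto (survival a lam x) atTop (nhds 0) := by
  have hrate : Continuous fun s => lam (flow a x s) := hcont.comp (continuous_flow_right x)
  set s₀ : ℝ := (y₀ + |x.1|) / a
  have hint (t : ℝ) (ht : s₀ ≤ t) :
      (∫ s in (0 : ℝ)..s₀, lam (flow a x s)) + (t - s₀) * lmin
        ≤ ∫ s in (0 : ℝ)..t, lam (flow a x s) := by
    have hmono : ∫ _ in s₀..t, lmin ≤ ∫ s in s₀..t, lam (flow a x s) :=
      intervalIntegral.integral_mono_on ht intervalIntegrable_const (hrate.intervalIntegrable _ _)
        fun s hs => hlow _ _ (le_sign_mul_drift ha x hs.1)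
    rw [intervalIntegral.integral_const, smul_eq_mul] at hmono
    rw [← intervalIntegral.integral_add_adjacent_intervals (hrate.intervalIntegrable 0 s₀)
      (hrate.intervalIntegrable s₀ t)]
    exact (add_le_add_iff_left _).2 hmono
  refine Real.tendsto_exp_atBot.comp (tendsto_neg_atTop_atBot.comp ?_)
  refine tendsto_atTop_mono' _ ((eventually_ge_atTop s₀).mono hint) ?_
  exact tendsto_atTop_add_const_left _ _
    ((tendsto_atTop_add_const_right _ (-s₀) tendsto_id).atTop_mul_const hmin)

/-- The density of the waiting time until the next switch, for the process in state `x`. -/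
def waitDensity (a : ℝ) (lam : State → ℝ) (x : State) (s : ℝ) : ℝ≥0∞ :=
  if 0 ≤ s then ENNReal.ofReal (lam (flow a x s) * survival a lam x s) else 0

@[fun_prop]
lemma measurable_waitDensity (hcont : Continuous lam) :
    Measurable fun p : State × ℝ => waitDensity a lam p.1 p.2 := by
  refine Measurable.ite (measurableSet_le measurable_const measurable_snd) ?_ measurable_const
  exact ((hcont.comp continuous_flow).mul (continuous_survival hcont)).measurable.ennreal_ofReal

/-- The law of the waiting time until the next switch, as a kernel from the current state. -/
def waitKernel (a : ℝ) (lam : State → ℝ) : Kernel State ℝ :=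
  (Kernel.const State (volume : Measure ℝ)).withDensity (waitDensity a lam)

lemma waitKernel_apply (hcont : Continuous lam) (x : State) :
    waitKernel a lam x = (volume : Measure ℝ).withDensity (waitDensity a lam x) := by
  rw [waitKernel, Kernel.withDensity_apply _ (measurable_waitDensity hcont), Kernel.const_apply]

lemma lintegral_waitKernel (hcont : Continuous lam) (x : State) {h : ℝ → ℝ≥0∞}
    (hh : Measurable h) :
    ∫⁻ s, h s ∂(waitKernel a lam x) = ∫⁻ s, waitDensity a lam x s * h s := by
  rw [waitKernel_apply hcont, lintegral_withDensity_eq_lintegral_mul _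
    ((measurable_waitDensity hcont).of_uncurry_left) hh]
  rfl

lemma waitKernel_Iic_zero (hcont : Continuous lam) (x : State) :
    waitKernel a lam x (Set.Iic 0) = 0 := by
  rw [waitKernel_apply hcont, withDensity_apply _ measurableSet_Iic,
    setLIntegral_congr Iio_ae_eq_Iic.symm, setLIntegral_eq_zero measurableSet_Iio]
  exact fun s hs => if_neg (not_le.2 hs)

lemma waitKernel_Ioi (hcont : Continuous lam) (hnonneg : ∀ x, 0 ≤ lam x)
    (hfin : ∀ x, Tendsto (survival a lam x) atTop (nhds 0)) (x : State) {t : ℝ} (ht : 0 ≤ t) :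
    waitKernel a lam x (Set.Ioi t) = ENNReal.ofReal (survival a lam x t) := by
  have hdensity : Set.EqOn (waitDensity a lam x)
      (fun s => ENNReal.ofReal (lam (flow a x s) * survival a lam x s)) (Set.Ioi t) :=
    fun s hs => if_pos (ht.trans (le_of_lt hs))
  have hd (s : ℝ) : HasDerivAt (fun r => -survival a lam x r)
      (lam (flow a x s) * survival a lam x s) s :=
    (hasDerivAt_survival hcont x s).neg.congr_deriv (neg_neg _)
  have hn (s : ℝ) : 0 ≤ lam (flow a x s) * survival a lam x s :=
    mul_nonneg (hnonneg _) (survival_pos _ _).le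
  have hc : ContinuousWithinAt (fun r => -survival a lam x r) (Set.Ici t) t :=
    (hd t).continuousAt.continuousWithinAt
  have hl : Tendsto (fun r => -survival a lam x r) atTop (nhds 0) := by
    simpa only [neg_zero] using (hfin x).neg
  rw [waitKernel_apply hcont, withDensity_apply _ measurableSet_Ioi,
    setLIntegral_congr_fun measurableSet_Ioi hdensity,
    ← ofReal_integral_eq_lintegral_ofReal
      (integrableOn_Ioi_deriv_of_nonneg hc (fun s _ => hd s) (fun s _ => hn s) hl)
      (ae_of_all _ hn),
    integral_Ioi_of_hasDerivAt_of_nonneg hc (fun s _ => hd s) (fun s _ => hn s) hl,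
    zero_sub, neg_neg]

lemma isMarkovKernel_waitKernel (hcont : Continuous lam) (hnonneg : ∀ x, 0 ≤ lam x)
    (hfin : ∀ x, Tendsto (survival a lam x) atTop (nhds 0)) :
    IsMarkovKernel (waitKernel a lam) := by
  refine ⟨fun x => ⟨?_⟩⟩
  rw [← Set.Iic_union_Ioi (a := (0 : ℝ)), measure_union (Set.Iic_disjoint_Ioi le_rfl)
    measurableSet_Ioi, waitKernel_Iic_zero hcont, waitKernel_Ioi hcont hnonneg hfin x le_rfl,
    survival_zero, ENNReal.ofReal_one, zero_add]

lemma continuous_rate_sub (hcont : Continuous lam) :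
    Continuous fun η : ℝ => lam (η, 1) - lam (η, -1) := by
  fun_prop

lemma hasDerivAt_potential (hcont : Continuous lam) (y : ℝ) :
    HasDerivAt (potential a lam) (1 / a * (lam (y, 1) - lam (y, -1))) y :=
  ((continuous_rate_sub hcont).integral_hasStrictDerivAt 0 y).hasDerivAt.const_mul _

lemma continuous_potential (hcont : Continuous lam) : Continuous (potential a lam) :=
  continuous_iff_continuousAt.2 fun y => (hasDerivAt_potential hcont y).continuousAt

lemma bddBelow_range_of_antitoneOn_of_monotoneOn {f : ℝ → ℝ} (hf : Continuous f) {u v : ℝ}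
    (hanti : AntitoneOn f (Set.Iic u)) (hmono : MonotoneOn f (Set.Ici v)) :
    BddBelow (Set.range f) := by
  obtain ⟨m, hm⟩ := (isCompact_Icc (a := u) (b := v)).bddBelow_image hf.continuousOn
  refine ⟨min m (min (f u) (f v)), ?_⟩
  rintro _ ⟨y, rfl⟩
  simp only [min_le_iff]
  rcases le_total y u with hy | hu
  · exact .inr (.inl (hanti hy Set.self_mem_Iic hy))
  rcases le_total v y with hy | hv
  · exact .inr (.inr (hmono Set.self_mem_Ici hy hy))
  · exact .inl (hm ⟨y, ⟨hu, hv⟩, rfl⟩)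

lemma bddBelow_range_potential {y₀ : ℝ} (ha : 0 < a) (hcont : Continuous lam)
    (hle : ∀ (y : ℝ) (j : ℤˣ), y₀ ≤ ((j : ℤ) : ℝ) * y → lam (y, -j) ≤ lam (y, j)) :
    BddBelow (Set.range (potential a lam)) := by
  refine bddBelow_range_of_antitoneOn_of_monotoneOn (continuous_potential hcont)
    (u := -y₀) (v := y₀) ?_ ?_
  · refine antitoneOn_of_hasDerivWithinAt_nonpos (convex_Iic _)
      (continuous_potential hcont).continuousOn
      (fun y _ => (hasDerivAt_potential hcont y).hasDerivWithinAt) fun y hy => ?_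
    have hy : y < -y₀ := by simpa using hy
    have hrate : lam (y, 1) ≤ lam (y, -1) := by
      simpa using hle y (-1) (by simpa using by linarith)
    exact mul_nonpos_of_nonneg_of_nonpos (by positivity) (sub_nonpos.2 hrate)
  · refine monotoneOn_of_hasDerivWithinAt_nonneg (convex_Ici _)
      (continuous_potential hcont).continuousOn
      (fun y _ => (hasDerivAt_potential hcont y).hasDerivWithinAt) fun y hy => ?_
    have hy : y₀ < y := by simpa using hy
    exact mul_nonneg (by positivity) (sub_nonneg.2 (hle y 1 (by simpa using hy.le)))

lemma potential_flow_sub (ha : a ≠ 0) (hcont : Continuous lam) (x : State) (t : ℝ) :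
    potential a lam (flow a x t).1 - potential a lam x.1
      = ∫ s in (0 : ℝ)..t, (lam (flow a x s) - lam (reverse (flow a x s))) := by
  have hderiv (s : ℝ) : HasDerivAt (fun r => potential a lam (flow a x r).1)
      (lam (flow a x s) - lam (reverse (flow a x s))) s := by
    have hdrift : HasDerivAt (drift a x) (a * ((x.2 : ℤ) : ℝ)) s :=
      ((hasDerivAt_const_mul _).const_add _)
    refine ((hasDerivAt_potential hcont _).comp s hdrift).congr_deriv ?_
    simp only [flow, reverse]
    rcases Int.units_eq_one_or x.2 with h | h
    · simp only [h, Units.val_one, Int.cast_one]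
      field_simp
    · simp only [h, Units.val_neg, Units.val_one, Int.cast_neg, Int.cast_one, neg_neg]
      field_simp
      ring
  have hint : Continuous fun s => lam (flow a x s) - lam (reverse (flow a x s)) :=
    (hcont.comp (continuous_flow_right x)).sub
      (hcont.comp (continuous_reverse.comp (continuous_flow_right x)))
  rw [intervalIntegral.integral_eq_sub_of_hasDerivAt (fun s _ => hderiv s)
    (hint.intervalIntegrable _ _), flow_zero]

/-- Skew detailed balance for the motion between two switches: by `potential_flow_sub`, the
increment of `Ψ` along the flow is exactly what is lost by running the flow backwards. -/
lemma survival_mul_exp_neg_potential (ha : a ≠ 0) (hcont : Continuous lam) (x : State) (t : ℝ) :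
    survival a lam x t * Real.exp (-potential a lam x.1)
      = survival a lam (reverse (flow a x t)) t
        * Real.exp (-potential a lam (flow a x t).1) := by
  have hback : ∫ s in (0 : ℝ)..t, lam (flow a (reverse (flow a x t)) s)
      = ∫ s in (0 : ℝ)..t, lam (reverse (flow a x s)) := by
    simp only [flow_reverse_flow]
    simpa using intervalIntegral.integral_comp_sub_left (a := (0 : ℝ)) (b := t)
      (fun s => lam (reverse (flow a x s))) t
  have hflow : Continuous fun s => lam (flow a x s) := hcont.comp (continuous_flow_right x)
  have hrev : Continuous fun s => lam (reverse (flow a x s)) :=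
    hcont.comp (continuous_reverse.comp (continuous_flow_right x))
  have hpot := potential_flow_sub ha hcont x t
  rw [intervalIntegral.integral_sub (hflow.intervalIntegrable _ _)
    (hrev.intervalIntegrable _ _), ← hback] at hpot
  change Real.exp (-∫ s in (0 : ℝ)..t, lam (flow a x s)) * _
    = Real.exp (-∫ s in (0 : ℝ)..t, lam (flow a (reverse (flow a x t)) s)) * _
  rw [← Real.exp_add, ← Real.exp_add]
  congr 1
  linarith

/-! ### The Dyson–Phillips expansion and skew symmetry -/

/-- The motion killed at rate `lam`: `killedFlow a lam f t x` is the expectation of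
`f (Y(t), J(t))` on the event that there is no switch up to time `t`. It is `0` for `t < 0`, which
allows the time integrals below to run over the whole line. -/
def killedFlow (a : ℝ) (lam : State → ℝ) (f : State → ℝ≥0∞) (t : ℝ) (x : State) : ℝ≥0∞ :=
  if 0 ≤ t then ENNReal.ofReal (survival a lam x t) * f (flow a x t) else 0

/-- The switching part of the generator: reversal of the direction at rate `lam`. -/
def switchOp (lam : State → ℝ) (f : State → ℝ≥0∞) (x : State) : ℝ≥0∞ :=
  ENNReal.ofReal (lam x) * f (reverse x)

/-- The `n`-th term of the Dyson–Phillips expansion of the transition semigroup: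
`dysonTerm a lam n f t x` is the expectation of `f (Y(t), J(t))` on the event that there are exactly
`n` switches up to time `t`. -/
def dysonTerm (a : ℝ) (lam : State → ℝ) : ℕ → (State → ℝ≥0∞) → ℝ → State → ℝ≥0∞
  | 0, f, t, x => killedFlow a lam f t x
  | n + 1, f, t, x => ∫⁻ s, killedFlow a lam (switchOp lam (dysonTerm a lam n f (t - s))) s x

section Measurability

variable {α : Type*} [MeasurableSpace α] {h : α → State → ℝ≥0∞} {τ : α → ℝ} {y : α → State}

@[fun_prop]
lemma measurable_killedFlow (hcont : Continuous lam)
    (hh : Measurable fun p : α × State => h p.1 p.2) (hτ : Measurable τ) (hy : Measurable y) :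
    Measurable fun p => killedFlow a lam (h p) (τ p) (y p) := by
  refine Measurable.ite (measurableSet_le measurable_const hτ) ?_ measurable_const
  have hyτ : Measurable fun p => (y p, τ p) := hy.prodMk hτ
  exact ((continuous_survival hcont).measurable.comp hyτ).ennreal_ofReal.mul
    (hh.comp (measurable_id.prodMk (measurable_flow.comp hyτ)))

@[fun_prop]
lemma measurable_switchOp (hcont : Continuous lam)
    (hh : Measurable fun p : α × State => h p.1 p.2) (hy : Measurable y) :
    Measurable fun p => switchOp lam (h p) (y p) :=
  (hcont.measurable.comp hy).ennreal_ofReal.mul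
    (hh.comp (measurable_id.prodMk (measurable_reverse.comp hy)))

@[fun_prop]
lemma measurable_dysonTerm (hcont : Continuous lam) (n : ℕ)
    (hh : Measurable fun p : α × State => h p.1 p.2) (hτ : Measurable τ) (hy : Measurable y) :
    Measurable fun p => dysonTerm a lam n (h p) (τ p) (y p) := by
  induction n generalizing α with
  | zero => exact measurable_killedFlow hcont hh hτ hy
  | succ n ih =>
    refine Measurable.lintegral_prod_right (measurable_killedFlow hcont
      (measurable_switchOp hcont (ih ?_ ?_ measurable_snd) measurable_snd) measurable_snd ?_)
    all_goals fun_prop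

end Measurability

lemma killedFlow_switchOp (hnonneg : ∀ x, 0 ≤ lam x) (f : State → ℝ≥0∞) (s : ℝ) (x : State) :
    killedFlow a lam (switchOp lam f) s x = waitDensity a lam x s * f (reverse (flow a x s)) := by
  unfold killedFlow waitDensity switchOp
  split_ifs
  · rw [ENNReal.ofReal_mul (hnonneg _)]
    ring
  · rw [zero_mul]

lemma dysonTerm_succ (hnonneg : ∀ x, 0 ≤ lam x) (n : ℕ) (f : State → ℝ≥0∞) (t : ℝ)
    (x : State) :
    dysonTerm a lam (n + 1) f t x
      = ∫⁻ s, waitDensity a lam x s * dysonTerm a lam n f (t - s) (reverse (flow a x s)) := by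
  simp only [dysonTerm, killedFlow_switchOp hnonneg]

/-- The definition of `dysonTerm` decomposes at the first switch, this identity at the last one. -/
lemma dysonTerm_succ_eq_lintegral_last_switch (hcont : Continuous lam) (hnonneg : ∀ x, 0 ≤ lam x)
    (n : ℕ) {f : State → ℝ≥0∞} (hf : Measurable f) (t : ℝ) (x : State) :
    dysonTerm a lam (n + 1) f t x
      = ∫⁻ s, dysonTerm a lam n (switchOp lam (killedFlow a lam f s)) (t - s) x := by
  induction n generalizing t x with
  | zero =>
    rw [← lintegral_sub_left_eq_self _ t]
    simp only [dysonTerm, sub_sub_cancel]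
  | succ n ih =>
    calc dysonTerm a lam (n + 1 + 1) f t x
        = ∫⁻ r, ∫⁻ s, waitDensity a lam x r * dysonTerm a lam n
            (switchOp lam (killedFlow a lam f s)) (t - r - s) (reverse (flow a x r)) := by
          simp only [dysonTerm_succ hnonneg (n + 1), ih]
          refine lintegral_congr fun r => (lintegral_const_mul _ ?_).symm
          fun_prop
      _ = ∫⁻ s, ∫⁻ r, waitDensity a lam x r * dysonTerm a lam n
            (switchOp lam (killedFlow a lam f s)) (t - r - s) (reverse (flow a x r)) := by
          refine lintegral_lintegral_swap (Measurable.aemeasurable ?_)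
          fun_prop
      _ = _ := by simp only [dysonTerm_succ hnonneg n, sub_right_comm t]

/-- `B` is the adjoint of `A` with respect to `μ` up to reversal of the direction of motion:
`⟨g, A f⟩ = ⟨R B R g, f⟩`, where `R` is the composition with `reverse`. Operators act on
nonnegative functions, so that no integrability has to be assumed. -/
def IsSkewAdjoint (μ : Measure State) (A B : (State → ℝ≥0∞) → State → ℝ≥0∞) : Prop :=
  ∀ ⦃f g : State → ℝ≥0∞⦄, Measurable f → Measurable g →
    ∫⁻ x, g x * A f x ∂μ = ∫⁻ x, B (g ∘ reverse) (reverse x) * f x ∂μ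

section SkewAdjoint

variable {μ : Measure State}

lemma IsSkewAdjoint.comp {A A' B B' : (State → ℝ≥0∞) → State → ℝ≥0∞}
    (hA : IsSkewAdjoint μ A A') (hB : IsSkewAdjoint μ B B')
    (hBm : ∀ f, Measurable f → Measurable (B f))
    (hAm' : ∀ f, Measurable f → Measurable (A' f)) :
    IsSkewAdjoint μ (A ∘ B) (B' ∘ A') := by
  intro f g hf hg
  have hg' : Measurable (A' (g ∘ reverse)) := hAm' _ (hg.comp measurable_reverse)
  have hrev : (A' (g ∘ reverse) ∘ reverse) ∘ reverse = A' (g ∘ reverse) := by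
    funext x
    simp only [Function.comp_apply, reverse_reverse]
  calc ∫⁻ x, g x * A (B f) x ∂μ
      = ∫⁻ x, A' (g ∘ reverse) (reverse x) * B f x ∂μ := hA (hBm f hf) hg
    _ = ∫⁻ x, B' ((A' (g ∘ reverse) ∘ reverse) ∘ reverse) (reverse x) * f x ∂μ :=
        hB hf (hg'.comp measurable_reverse)
    _ = ∫⁻ x, B' (A' (g ∘ reverse)) (reverse x) * f x ∂μ := by rw [hrev]

lemma IsSkewAdjoint.lintegral [SFinite μ] {ι : Type*} [MeasurableSpace ι] {ν : Measure ι}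
    [SFinite ν] {A B : ι → (State → ℝ≥0∞) → State → ℝ≥0∞}
    (h : ∀ s, IsSkewAdjoint μ (A s) (B s))
    (hA : ∀ f, Measurable f → Measurable fun p : State × ι => A p.2 f p.1)
    (hB : ∀ f, Measurable f → Measurable fun p : State × ι => B p.2 f p.1) :
    IsSkewAdjoint μ (fun f x => ∫⁻ s, A s f x ∂ν) (fun f x => ∫⁻ s, B s f x ∂ν) := by
  intro f g hf hg
  have hAf : Measurable fun p : State × ι => A p.2 f p.1 := hA f hf
  have hBg : Measurable fun p : State × ι => B p.2 (g ∘ reverse) (reverse p.1) :=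
    (hB _ (hg.comp measurable_reverse)).comp (by fun_prop :
      Measurable fun p : State × ι => (reverse p.1, p.2))
  calc ∫⁻ x, g x * ∫⁻ s, A s f x ∂ν ∂μ
      = ∫⁻ x, ∫⁻ s, g x * A s f x ∂ν ∂μ :=
        lintegral_congr fun x => (lintegral_const_mul _ (hAf.comp measurable_prodMk_left)).symm
    _ = ∫⁻ s, ∫⁻ x, g x * A s f x ∂μ ∂ν :=
        lintegral_lintegral_swap (((hg.comp measurable_fst).mul hAf).aemeasurable)
    _ = ∫⁻ s, ∫⁻ x, B s (g ∘ reverse) (reverse x) * f x ∂μ ∂ν :=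
        lintegral_congr fun s => h s hf hg
    _ = ∫⁻ x, ∫⁻ s, B s (g ∘ reverse) (reverse x) * f x ∂ν ∂μ :=
        (lintegral_lintegral_swap ((hBg.mul (hf.comp measurable_fst)).aemeasurable)).symm
    _ = ∫⁻ x, (∫⁻ s, B s (g ∘ reverse) (reverse x) ∂ν) * f x ∂μ :=
        lintegral_congr fun x => lintegral_mul_const _ (hBg.comp measurable_prodMk_left)

end SkewAdjoint

instance : SFinite (invMeasure a lam) := by
  unfold invMeasure
  infer_instance

lemma lintegral_invMeasure (hcont : Continuous lam) {h : State → ℝ≥0∞} (hh : Measurable h) :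
    ∫⁻ x, h x ∂(invMeasure a lam)
      = ∫⁻ x, ENNReal.ofReal (Real.exp (-potential a lam x.1)) * h x
          ∂((volume : Measure ℝ).prod (Measure.count : Measure ℤˣ)) := by
  have := (continuous_potential (a := a) hcont).measurable
  rw [invMeasure, lintegral_withDensity_eq_lintegral_mul _ (by fun_prop) hh]
  rfl

lemma lintegral_comp_reverse_invMeasure (hcont : Continuous lam) {h : State → ℝ≥0∞}
    (hh : Measurable h) :
    ∫⁻ x, h (reverse x) ∂(invMeasure a lam) = ∫⁻ x, h x ∂(invMeasure a lam) := by
  have := (continuous_potential (a := a) hcont).measurable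
  rw [lintegral_invMeasure hcont hh, lintegral_invMeasure hcont (by fun_prop),
    lintegral_prod _ (by fun_prop), lintegral_prod _ (by fun_prop)]
  refine lintegral_congr fun y => ?_
  rw [lintegral_count, lintegral_count]
  exact (Equiv.neg ℤˣ).tsum_eq
    fun j => ENNReal.ofReal (Real.exp (-potential a lam y)) * h (y, j)

lemma lintegral_comp_flow {h : State → ℝ≥0∞} (hh : Measurable h) (t : ℝ) :
    ∫⁻ x, h (flow a x t) ∂((volume : Measure ℝ).prod (Measure.count : Measure ℤˣ))
      = ∫⁻ x, h x ∂((volume : Measure ℝ).prod (Measure.count : Measure ℤˣ)) := by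
  rw [lintegral_prod_symm _ (by fun_prop), lintegral_prod_symm _ (by fun_prop)]
  exact lintegral_congr fun j =>
    lintegral_add_right_eq_self (fun y => h (y, j)) (a * ((j : ℤ) : ℝ) * t)

lemma isSkewAdjoint_killedFlow (ha : a ≠ 0) (hcont : Continuous lam) (t : ℝ) :
    IsSkewAdjoint (invMeasure a lam) (fun f => killedFlow a lam f t)
      (fun f => killedFlow a lam f t) := by
  intro f g hf hg
  by_cases ht : 0 ≤ t
  swap
  · simp only [killedFlow, if_neg ht, mul_zero, zero_mul]
  have := (continuous_potential (a := a) hcont).measurable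
  rw [lintegral_invMeasure hcont (by fun_prop), lintegral_invMeasure hcont (by fun_prop)]
  refine (lintegral_congr fun x => ?_).trans (lintegral_comp_flow (a := a) (by fun_prop) t)
  have hbalance := congrArg ENNReal.ofReal (survival_mul_exp_neg_potential ha hcont x t)
  rw [ENNReal.ofReal_mul (survival_pos _ _).le, ENNReal.ofReal_mul (survival_pos _ _).le]
    at hbalance
  simp only [killedFlow, if_pos ht, Function.comp_apply, flow_reverse_flow, sub_self, flow_zero,
    reverse_reverse]
  calc _ = ENNReal.ofReal (survival a lam x t) * ENNReal.ofReal (Real.exp (-potential a lam x.1))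
        * (g x * f (flow a x t)) := by ring
    _ = _ := by
      rw [hbalance]
      ring

lemma isSkewAdjoint_switchOp (hcont : Continuous lam) :
    IsSkewAdjoint (invMeasure a lam) (switchOp lam) (switchOp lam) := by
  intro f g hf hg
  rw [← lintegral_comp_reverse_invMeasure hcont (by fun_prop)]
  refine lintegral_congr fun x => ?_
  simp only [switchOp, Function.comp_apply, reverse_reverse]
  ring

lemma isSkewAdjoint_dysonTerm (ha : a ≠ 0) (hcont : Continuous lam)
    (hnonneg : ∀ x, 0 ≤ lam x) (n : ℕ) (t : ℝ) :
    IsSkewAdjoint (invMeasure a lam) (fun f => dysonTerm a lam n f t)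
      (fun f => dysonTerm a lam n f t) := by
  induction n generalizing t with
  | zero => exact isSkewAdjoint_killedFlow ha hcont t
  | succ n ih =>
    have hfirst (s : ℝ) := (isSkewAdjoint_killedFlow ha hcont s).comp
      ((isSkewAdjoint_switchOp hcont).comp (ih (t - s)) (fun f hf => by fun_prop)
        fun f hf => by fun_prop) (fun f hf => by fun_prop) fun f hf => by fun_prop
    have hint := IsSkewAdjoint.lintegral (ν := volume) hfirst
      (fun f hf => by fun_prop) (fun f hf => by fun_prop)
    intro f g hf hg
    refine (hint hf hg).trans (lintegral_congr fun x => ?_)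
    beta_reduce
    rw [dysonTerm_succ_eq_lintegral_last_switch hcont hnonneg n (hg.comp measurable_reverse)]
    rfl

/-! ### Conditional laws of the waiting times -/

lemma eq_of_forall_measure_Ioi_rat_eq {μ ν : Measure ℝ} [IsProbabilityMeasure μ]
    [IsProbabilityMeasure ν] (hν : ν (Set.Ioi 0) = 1)
    (h : ∀ q : ℚ, 0 ≤ q → μ (Set.Ioi (q : ℝ)) = ν (Set.Ioi (q : ℝ))) : μ = ν := by
  refine ext_of_generate_finite _
    ((BorelSpace.measurable_eq (α := ℝ)).trans Real.borel_eq_generateFrom_Ioi_rat)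
    Real.isPiSystem_Ioi_rat ?_ (by simp)
  simp only [Set.mem_iUnion, Set.mem_singleton_iff, forall_exists_index]
  rintro _ q rfl
  rcases le_total 0 q with hq | hq
  · exact h q hq
  · have hsub : Set.Ioi (0 : ℝ) ⊆ Set.Ioi (q : ℝ) := Set.Ioi_subset_Ioi (by exact_mod_cast hq)
    have hμ : μ (Set.Ioi 0) = 1 := by simpa [hν] using h 0 le_rfl
    rw [prob_le_one.antisymm (hμ.ge.trans (measure_mono hsub)),
      prob_le_one.antisymm (hν.ge.trans (measure_mono hsub))]

lemma hasCondDistrib_iff_condDistrib_ae_eq {Ω β γ : Type*} [MeasurableSpace Ω]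
    [MeasurableSpace β] [MeasurableSpace γ] [StandardBorelSpace γ] [Nonempty γ] {Q : Measure Ω}
    [IsFiniteMeasure Q] {X : Ω → β} {Y : Ω → γ} {κ : Kernel β γ} [IsFiniteKernel κ]
    (hX : Measurable X) (hY : Measurable Y) :
    HasCondDistrib Y X κ Q ↔ condDistrib Y X Q =ᵐ[Q.map X] κ := by
  rw [condDistrib_ae_eq_iff_measure_eq_compProd X hY.aemeasurable κ]
  exact ⟨fun h => h.map_eq, fun h => ⟨(hX.prodMk hY).aemeasurable, h⟩⟩

lemma hasCondDistrib_iff_condProb_lt {Ω β : Type*} [MeasurableSpace Ω] [mβ : MeasurableSpace β]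
    {Q : Measure Ω} [IsFiniteMeasure Q] {X : Ω → β} {Y : Ω → ℝ} {κ : Kernel β ℝ}
    [IsMarkovKernel κ] (hX : Measurable X) (hY : Measurable Y)
    (hκ : ∀ b, κ b (Set.Ioi 0) = 1) :
    HasCondDistrib Y X κ Q ↔ ∀ t : ℝ, 0 ≤ t →
      Q⟦{ω | t < Y ω} | mβ.comap X⟧ =ᵐ[Q] fun ω => (κ (X ω)).real (Set.Ioi t) := by
  have hcond (t : ℝ) : (fun ω => (condDistrib Y X Q (X ω)).real (Set.Ioi t))
      =ᵐ[Q] Q⟦{ω | t < Y ω} | mβ.comap X⟧ :=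
    condDistrib_ae_eq_condExp hX hY measurableSet_Ioi
  rw [hasCondDistrib_iff_condDistrib_ae_eq hX hY]
  constructor
  · intro h t _
    filter_upwards [ae_of_ae_map hX.aemeasurable h, hcond t] with ω hω hωt
    rw [← hωt, hω]
  · intro h
    have hrat : ∀ᵐ b ∂Q.map X, ∀ q : ℚ, 0 ≤ q →
        condDistrib Y X Q b (Set.Ioi (q : ℝ)) = κ b (Set.Ioi (q : ℝ)) := by
      refine ae_all_iff.2 fun q => eventually_imp_distrib_left.2 fun hq => ?_
      rw [ae_map_iff hX.aemeasurable (measurableSet_eq_fun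
        (Kernel.measurable_coe _ measurableSet_Ioi) (Kernel.measurable_coe _ measurableSet_Ioi))]
      filter_upwards [hcond q, h q (by exact_mod_cast hq)] with ω hω hωq
      rwa [← measureReal_eq_measureReal_iff, hω]
    filter_upwards [hrat] with b hb
    exact eq_of_forall_measure_Ioi_rat_eq (hκ b) hb

lemma lintegral_of_hasCondDistrib {Ω β γ : Type*} [MeasurableSpace Ω] [MeasurableSpace β]
    [MeasurableSpace γ] {Q : Measure Ω} [SFinite Q] {X : Ω → β} {Y : Ω → γ} {κ : Kernel β γ}
    [IsSFiniteKernel κ] (h : HasCondDistrib Y X κ Q) {H : β × γ → ℝ≥0∞} (hH : Measurable H) :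
    ∫⁻ ω, H (X ω, Y ω) ∂Q = ∫⁻ ω, ∫⁻ s, H (X ω, s) ∂κ (X ω) ∂Q := by
  rw [← lintegral_map' hH.aemeasurable h.aemeasurable, h.map_eq, Measure.lintegral_compProd hH,
    lintegral_map' hH.lintegral_kernel_prod_right'.aemeasurable h.aemeasurable_fst]

/-- The time of the `n`-th switch together with the state right after it. -/
def switchState (a : ℝ) (x : State) (z : ℕ → ℝ) (n : ℕ) : ℝ × State :=
  (switchTime z n, skeleton a x z n)

lemma switchTime_succ (z : ℕ → ℝ) (n : ℕ) : switchTime z (n + 1) = switchTime z n + z n :=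
  Finset.sum_range_succ _ _

lemma switchState_zero (x : State) (z : ℕ → ℝ) : switchState a x z 0 = (0, x) := by
  simp [switchState, switchTime, skeleton]

lemma switchState_succ (x : State) (z : ℕ → ℝ) (n : ℕ) :
    switchState a x z (n + 1) = ((switchState a x z n).1 + z n,
      reverse (flow a (switchState a x z n).2 (z n))) :=
  Prod.ext (switchTime_succ z n) rfl

@[fun_prop]
lemma measurable_switchState (x : State) (n : ℕ) :
    Measurable fun z => switchState a x z n := by
  induction n with
  | zero => simp only [switchState_zero]; fun_prop
  | succ n ih =>
    simp only [switchState_succ]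
    have hz : Measurable fun z : ℕ → ℝ => z n := measurable_pi_apply n
    exact (ih.fst.add hz).prodMk (measurable_reverse.comp (measurable_flow.comp (ih.snd.prodMk hz)))

/-- A waiting time sequence with a given beginning; the choice of the remaining waiting times
does not affect the `n`-th switch. -/
def extendHistory (n : ℕ) (z : Fin n → ℝ) : ℕ → ℝ := Function.extend Fin.val z 0

lemma measurable_extendHistory (n : ℕ) : Measurable (extendHistory n) := by
  refine measurable_pi_lambda _ fun k => ?_
  by_cases hk : k < n
  · simpa only [extendHistory, Fin.val_injective.extend_apply _ _ (⟨k, hk⟩ : Fin n)]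
      using measurable_pi_apply (⟨k, hk⟩ : Fin n)
  · have hk' : ¬∃ i : Fin n, i.val = k := fun ⟨i, hi⟩ => hk (hi ▸ i.isLt)
    simp only [extendHistory, Function.extend_apply' _ _ _ hk', measurable_const]

lemma switchState_extendHistory (x : State) (z : ℕ → ℝ) (n : ℕ) :
    switchState a x (extendHistory n fun k => z k) n = switchState a x z n := by
  have hcongr {z z' : ℕ → ℝ} : ∀ {m : ℕ}, (∀ k < m, z k = z' k) →
      switchState a x z m = switchState a x z' m := by
    intro m h
    induction m with
    | zero => simp only [switchState_zero]
    | succ m ih =>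
      simp only [switchState_succ, ih fun k hk => h k (hk.trans m.lt_succ_self),
        h m m.lt_succ_self]
  exact hcongr fun k hk => Fin.val_injective.extend_apply _ _ (⟨k, hk⟩ : Fin n)

/-- The conditional law of the `n`-th waiting time of the process started in `x`, given the
preceding ones. -/
def stepKernel (a : ℝ) (lam : State → ℝ) (x : State) (n : ℕ) : Kernel (Fin n → ℝ) ℝ :=
  (waitKernel a lam).comap (fun z => (switchState a x (extendHistory n z) n).2)
    ((measurable_switchState x n).comp (measurable_extendHistory n)).snd

lemma isMarkovKernel_stepKernel (hcont : Continuous lam) (hnonneg : ∀ x, 0 ≤ lam x)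
    (hfin : ∀ x, Tendsto (survival a lam x) atTop (nhds 0)) (x : State) (n : ℕ) :
    IsMarkovKernel (stepKernel a lam x n) := by
  have := isMarkovKernel_waitKernel hcont hnonneg hfin
  unfold stepKernel
  infer_instance

section Realisation

variable {Ω : Type*} [MeasurableSpace Ω] {Q : Measure Ω} {Z : ℕ → Ω → ℝ} {x : State}

lemma IsZigZag.measurable_switchState (hZ : IsZigZag a lam x Q Z) (n : ℕ) :
    Measurable fun ω => switchState a x (fun k => Z k ω) n :=
  (ZigZag.measurable_switchState x n).comp (measurable_pi_lambda _ hZ.measurable)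

variable [IsProbabilityMeasure Q]

lemma isZigZag_iff_hasCondDistrib (hcont : Continuous lam) (hnonneg : ∀ x, 0 ≤ lam x)
    (hfin : ∀ x, Tendsto (survival a lam x) atTop (nhds 0)) :
    IsZigZag a lam x Q Z ↔ (∀ i, Measurable (Z i)) ∧
      ∀ i, HasCondDistrib (Z i) (fun ω (k : Fin i) => Z k ω) (stepKernel a lam x i) Q := by
  have := isMarkovKernel_waitKernel hcont hnonneg hfin
  have hstep (i : ℕ) {t : ℝ} (ht : 0 ≤ t) :
      (fun ω => (stepKernel a lam x i fun k => Z k ω).real (Set.Ioi t))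
        = fun ω => survival a lam (skeleton a x (fun k => Z k ω) i) t := by
    funext ω
    rw [measureReal_def, stepKernel, Kernel.comap_apply,
      switchState_extendHistory x (fun k => Z k ω) i, waitKernel_Ioi hcont hnonneg hfin _ ht,
      ENNReal.toReal_ofReal (survival_pos _ _).le, switchState]
  have hpos (i : ℕ) (z : Fin i → ℝ) : stepKernel a lam x i z (Set.Ioi 0) = 1 := by
    rw [stepKernel, Kernel.comap_apply, waitKernel_Ioi hcont hnonneg hfin _ le_rfl,
      survival_zero, ENNReal.ofReal_one]
  have := isMarkovKernel_stepKernel hcont hnonneg hfin x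
  have hiff (hm : ∀ i, Measurable (Z i)) (i : ℕ) :
      HasCondDistrib (Z i) (fun ω (k : Fin i) => Z k ω) (stepKernel a lam x i) Q ↔
        ∀ t : ℝ, 0 ≤ t → Q⟦{ω | t < Z i ω} |
          MeasurableSpace.comap (fun ω (k : Fin i) => Z k ω) MeasurableSpace.pi⟧
          =ᵐ[Q] fun ω => survival a lam (skeleton a x (fun k => Z k ω) i) t := by
    rw [hasCondDistrib_iff_condProb_lt (by fun_prop) (hm i) (hpos i)]
    exact forall₂_congr fun t ht => by rw [hstep i ht]
  exact ⟨fun hZ => ⟨hZ.measurable, fun i => (hiff hZ.measurable i).2 (hZ.cond_survival i)⟩,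
    fun ⟨hm, h⟩ => ⟨hm, fun i => (hiff hm i).1 (h i)⟩⟩

namespace IsZigZag

lemma ae_pos (hZ : IsZigZag a lam x Q Z) : ∀ᵐ ω ∂Q, ∀ i, 0 < Z i ω := by
  refine ae_all_iff.2 fun i => ?_
  have hlt : MeasurableSet {ω | 0 < Z i ω} := measurableSet_lt measurable_const (hZ.measurable i)
  have hhist : Measurable fun ω (k : Fin i) => Z k ω :=
    measurable_pi_lambda _ fun k => hZ.measurable k
  have h := integral_condExp hhist.comap_le (μ := Q)
    (f := {ω | 0 < Z i ω}.indicator fun _ => (1 : ℝ))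
  rw [integral_congr_ae (hZ.cond_survival i 0 le_rfl), integral_indicator_const _ hlt] at h
  simp only [survival_zero, integral_const, probReal_univ, smul_eq_mul, mul_one] at h
  rw [ae_iff_prob_eq_one (measurable_const.lt (hZ.measurable i)),
    ← ENNReal.toReal_eq_one_iff]
  exact h.symm

lemma hasCondDistrib_switchState (hcont : Continuous lam) (hnonneg : ∀ x, 0 ≤ lam x)
    (hfin : ∀ x, Tendsto (survival a lam x) atTop (nhds 0)) (hZ : IsZigZag a lam x Q Z) (n : ℕ) :
    HasCondDistrib (Z n) (fun ω => switchState a x (fun k => Z k ω) n)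
      ((waitKernel a lam).prodMkLeft ℝ) Q := by
  have := isMarkovKernel_waitKernel hcont hnonneg hfin
  have h := ((isZigZag_iff_hasCondDistrib hcont hnonneg hfin).1 hZ).2 n
  have hcomp := HasCondDistrib.comp_right (κ := (waitKernel a lam).prodMkLeft ℝ)
    (hf := (ZigZag.measurable_switchState (a := a) x n).comp (measurable_extendHistory n)) h
  have hstate : (fun ω => switchState a x (extendHistory n fun k => Z k ω) n)
      = fun ω => switchState a x (fun k => Z k ω) n :=
    funext fun ω => switchState_extendHistory x (fun k => Z k ω) n
  rwa [← hstate]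

end IsZigZag

end Realisation

lemma exists_measure_forall_hasCondDistrib {E : Type*} [MeasurableSpace E]
    (κ : ∀ n, Kernel (Fin n → E) E) [∀ n, IsMarkovKernel (κ n)] :
    ∃ Q : Measure (ℕ → E), IsProbabilityMeasure Q ∧
      ∀ n, HasCondDistrib (fun ω => ω n) (fun ω (k : Fin n) => ω k) (κ n) Q := by
  obtain ⟨e⟩ := nonempty_of_isProbabilityMeasure (κ 0 Fin.elim0)
  -- Mathlib's trajectories have a starting point, here a dummy coordinate with index `0`.
  let past (n : ℕ) (h : (i : Finset.Iic n) → E) (k : Fin n) : E :=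
    h ⟨k + 1, Finset.mem_Iic.2 k.isLt⟩
  have hpast (n : ℕ) : Measurable (past n) := by fun_prop
  let η (n : ℕ) : Kernel ((i : Finset.Iic n) → E) E := (κ n).comap (past n) (hpast n)
  have (n : ℕ) : IsMarkovKernel (η n) := by unfold η; infer_instance
  let R := Kernel.trajMeasure (X := fun _ => E) (Measure.dirac e) η
  have hR (n : ℕ) : HasCondDistrib (fun ω : ℕ → E => ω (n + 1)) (Preorder.frestrictLe n) (η n) R :=
    ⟨by fun_prop, (Kernel.map_frestrictLe_trajMeasure_compProd_eq_map_trajMeasure).symm⟩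
  have hshift : Measurable fun (ω : ℕ → E) n => ω (n + 1) := by fun_prop
  refine ⟨R.map fun ω n => ω (n + 1), Measure.isProbabilityMeasure_map hshift.aemeasurable,
    fun n => ?_⟩
  have h := HasCondDistrib.comp_right (hf := hpast n) (hR n)
  refine ⟨by fun_prop, ?_⟩
  rw [Measure.map_map (by fun_prop) hshift, Measure.map_map (by fun_prop) hshift]
  exact h.map_eq

lemma exists_isZigZag (hcont : Continuous lam) (hnonneg : ∀ x, 0 ≤ lam x)
    (hfin : ∀ x, Tendsto (survival a lam x) atTop (nhds 0)) (x : State) :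
    ∃ (Ω : Type) (_ : MeasurableSpace Ω) (Q : Measure Ω) (Z : ℕ → Ω → ℝ),
      IsProbabilityMeasure Q ∧ IsZigZag a lam x Q Z := by
  have := isMarkovKernel_stepKernel hcont hnonneg hfin x
  obtain ⟨Q, hQ, hcond⟩ := exists_measure_forall_hasCondDistrib (stepKernel a lam x)
  exact ⟨ℕ → ℝ, inferInstance, Q, fun n ω => ω n, hQ,
    (isZigZag_iff_hasCondDistrib hcont hnonneg hfin).2 ⟨measurable_pi_apply, hcond⟩⟩

/-! ### Non-explosion -/

lemma abs_skeleton_sub_le {z : ℕ → ℝ} (hz : ∀ k, 0 ≤ z k) (x : State) (n : ℕ) :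
    |(skeleton a x z n).1 - x.1| ≤ |a| * switchTime z n := by
  induction n with
  | zero => simp [skeleton, switchTime]
  | succ n ih =>
    have hstep : (skeleton a x z (n + 1)).1 - x.1
        = ((skeleton a x z n).1 - x.1) + a * ((skeleton a x z n).2 : ℤ) * z n := by
      simp only [skeleton, drift]
      ring
    rw [hstep, switchTime_succ, mul_add]
    refine (abs_add_le _ _).trans (add_le_add ih ?_)
    rw [abs_mul, abs_mul, abs_sign, abs_of_nonneg (hz n), mul_one]

lemma exists_pos_forall_le_survival (hcont : Continuous lam) (y R t : ℝ) :
    ∃ c > 0, ∀ x : State, |x.1 - y| ≤ R → c ≤ survival a lam x t := by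
  have hcompact : IsCompact (Metric.closedBall y R ×ˢ (Set.univ : Set ℤˣ)) :=
    (isCompact_closedBall y R).prod isCompact_univ
  obtain ⟨c, hc, hle⟩ := hcompact.exists_forall_le' (f := fun x => survival a lam x t)
    ((continuous_survival hcont).comp (Continuous.prodMk_left t)).continuousOn
    fun x _ => survival_pos x t
  exact ⟨c, hc, fun x hx => hle x ⟨hx, Set.mem_univ _⟩⟩

lemma tendsto_sum_survival_of_switchTime_le (hcont : Continuous lam) {z : ℕ → ℝ}
    (hz : ∀ k, 0 ≤ z k) {S : ℝ} (hS : ∀ n, switchTime z n ≤ S) (x : State) (t : ℝ) :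
    Tendsto (fun n => ∑ k ∈ Finset.range n, survival a lam (skeleton a x z k) t) atTop atTop := by
  obtain ⟨c, hc, hle⟩ := exists_pos_forall_le_survival (a := a) hcont x.1 (|a| * S) t
  refine tendsto_atTop_mono (fun n => ?_) (tendsto_natCast_atTop_atTop.atTop_mul_const hc)
  have hterm (k : ℕ) : c ≤ survival a lam (skeleton a x z k) t := hle _ <|
    (abs_skeleton_sub_le hz x k).trans (mul_le_mul_of_nonneg_left (hS k) (abs_nonneg a))
  simpa using Finset.card_nsmul_le_sum (Finset.range n) _ c fun k _ => hterm k

lemma tendsto_switchTime_of_sum_survival (hcont : Continuous lam) {z : ℕ → ℝ}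
    (hz : ∀ k, 0 ≤ z k) (x : State)
    (h : Tendsto (fun n => ∑ k ∈ Finset.range n, survival a lam (skeleton a x z k) 1) atTop atTop →
      ∃ᶠ k in atTop, 1 < z k) :
    Tendsto (switchTime z) atTop atTop := by
  by_contra hT
  have hsum : Summable z := by
    by_contra hsum
    exact hT ((not_summable_iff_tendsto_nat_atTop_of_nonneg hz).1 hsum)
  have hbound (n : ℕ) : switchTime z n ≤ ∑' k, z k := hsum.sum_le_tsum _ fun k _ => hz k
  refine h (tendsto_sum_survival_of_switchTime_le hcont hz hbound x 1) ?_
  filter_upwards [hsum.tendsto_atTop_zero.eventually_le_const one_pos] with k hk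
  exact not_lt.2 hk

/-- The filtration generated by the successive waiting times: the `n`-th σ-algebra is that of the
first `n` of them. -/
def waitFiltration {Ω : Type*} [mΩ : MeasurableSpace Ω] (Z : ℕ → Ω → ℝ)
    (hZ : ∀ n, Measurable (Z n)) : Filtration ℕ mΩ where
  seq n := MeasurableSpace.comap (fun ω (k : Fin n) => Z k ω) MeasurableSpace.pi
  mono' m n hmn := by
    have hrestrict : Measurable fun (z : Fin n → ℝ) (k : Fin m) => z (Fin.castLE hmn k) := by
      fun_prop
    exact (hrestrict.comp (comap_measurable fun ω (k : Fin n) => Z k ω)).comap_le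
  le' n := (measurable_pi_lambda _ fun k : Fin n => hZ k).comap_le

section

variable {Ω : Type*} [mΩ : MeasurableSpace Ω] {Q : Measure Ω} [IsProbabilityMeasure Q]
  {Z : ℕ → Ω → ℝ} {x : State}

lemma IsZigZag.ae_frequently_lt (hZ : IsZigZag a lam x Q Z) {t : ℝ} (ht : 0 ≤ t) :
    ∀ᵐ ω ∂Q, Tendsto (fun n => ∑ k ∈ Finset.range n,
        survival a lam (skeleton a x (fun k => Z k ω) k) t) atTop atTop →
      ∃ᶠ k in atTop, t < Z k ω := by
  let s : ℕ → Set Ω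
    | 0 => ∅
    | k + 1 => {ω | t < Z k ω}
  have hs (n : ℕ) : MeasurableSet[waitFiltration Z hZ.measurable n] (s n) := by
    cases n with
    | zero => exact @MeasurableSet.empty _ (_)
    | succ k =>
      exact ((measurable_pi_apply (Fin.last k)).comp
        (comap_measurable fun ω (i : Fin (k + 1)) => Z i ω)) measurableSet_Ioi
  have hcond : ∀ᵐ ω ∂Q, ∀ k,
      Q[(s (k + 1)).indicator (1 : Ω → ℝ) | waitFiltration Z hZ.measurable k] ω
        = survival a lam (skeleton a x (fun k => Z k ω) k) t :=
    ae_all_iff.2 fun k => hZ.cond_survival k t ht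
  filter_upwards [ae_mem_limsup_atTop_iff Q hs, hcond] with ω hω hωcond hdiv
  simp only [hωcond] at hω
  have hfreq := mem_limsup_iff_frequently_mem.1 (hω.2 hdiv)
  rwa [← map_add_atTop_eq_nat 1, frequently_map] at hfreq

lemma IsZigZag.tendsto_switchTime (hcont : Continuous lam) (hZ : IsZigZag a lam x Q Z) :
    ∀ᵐ ω ∂Q, Tendsto (switchTime fun k => Z k ω) atTop atTop := by
  filter_upwards [hZ.ae_pos, hZ.ae_frequently_lt zero_le_one] with ω hpos hfreq
  exact tendsto_switchTime_of_sum_survival hcont (fun k => (hpos k).le) x hfreq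

end

/-! ### The law of the path -/

lemma numSwitches_eq {z : ℕ → ℝ} (hz : ∀ k, 0 ≤ z k) {t : ℝ} {n : ℕ}
    (hle : switchTime z n ≤ t) (hlt : t < switchTime z (n + 1)) : numSwitches z t = n := by
  have hmono : Monotone (switchTime z) :=
    monotone_nat_of_le_succ fun n => by rw [switchTime_succ]; linarith [hz n]
  refine IsGreatest.csSup_eq ⟨hle, fun k hk => ?_⟩
  by_contra hkn
  exact absurd ((hmono (not_le.1 hkn)).trans hk) (not_le.2 hlt)

lemma exists_switchTime_le_lt {z : ℕ → ℝ} (hz : Tendsto (switchTime z) atTop atTop) {t : ℝ}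
    (ht : 0 ≤ t) : ∃ n, switchTime z n ≤ t ∧ t < switchTime z (n + 1) := by
  have hex : ∃ n, t < switchTime z (n + 1) :=
    ((hz.comp (tendsto_add_atTop_nat 1)).eventually_gt_atTop t).exists
  classical
  refine ⟨Nat.find hex, ?_, Nat.find_spec hex⟩
  rcases hn : Nat.find hex with _ | n
  · simpa [switchTime] using ht
  · exact not_lt.1 (Nat.find_min hex (hn ▸ n.lt_succ_self))

lemma path_eq_flow {z : ℕ → ℝ} (hz : ∀ k, 0 ≤ z k) (x : State) {t : ℝ} {n : ℕ}
    (hle : switchTime z n ≤ t) (hlt : t < switchTime z (n + 1)) :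
    path a x z t = flow a (skeleton a x z n) (t - switchTime z n) := by
  simp only [path, numSwitches_eq hz hle hlt, flow]

/-- The value of `f` at the state at time `t` of a particle that starts in `y` and switches for the
first time at time `s`, counted only if `0 ≤ t < s`. -/
def beforeSwitch (a : ℝ) (f : State → ℝ≥0∞) (t : ℝ) (y : State) (s : ℝ) : ℝ≥0∞ :=
  (Set.Ico 0 s).indicator (fun r => f (flow a y r)) t

lemma apply_path_eq_tsum_beforeSwitch {z : ℕ → ℝ} (hz : ∀ k, 0 ≤ z k)
    (hT : Tendsto (switchTime z) atTop atTop) (x : State) (f : State → ℝ≥0∞) {t : ℝ}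
    (ht : 0 ≤ t) :
    f (path a x z t) = ∑' n, beforeSwitch a f (t - switchTime z n) (skeleton a x z n) (z n) := by
  have hmem (n : ℕ) : t - switchTime z n ∈ Set.Ico 0 (z n) ↔
      switchTime z n ≤ t ∧ t < switchTime z (n + 1) := by
    rw [Set.mem_Ico, sub_nonneg, sub_lt_iff_lt_add', switchTime_succ]
  obtain ⟨n, hn⟩ := exists_switchTime_le_lt hT ht
  rw [tsum_eq_single n, beforeSwitch, Set.indicator_of_mem ((hmem n).2 hn),
    path_eq_flow hz x hn.1 hn.2]
  refine fun m hmn => Set.indicator_of_notMem (fun hm => hmn ?_) _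
  obtain ⟨hle, hlt⟩ := (hmem m).1 hm
  rw [← numSwitches_eq hz hle hlt, numSwitches_eq hz hn.1 hn.2]

lemma measurable_beforeSwitch {f : State → ℝ≥0∞} (hf : Measurable f) (t : ℝ) :
    Measurable fun p : (ℝ × State) × ℝ => beforeSwitch a f (t - p.1.1) p.1.2 p.2 := by
  have hflow : Measurable fun p : (ℝ × State) × ℝ => f (flow a p.1.2 (t - p.1.1)) := by fun_prop
  have htime : Measurable fun p : (ℝ × State) × ℝ => t - p.1.1 := by fun_prop
  have hset : MeasurableSet {p : (ℝ × State) × ℝ | t - p.1.1 ∈ Set.Ico 0 p.2} :=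
    (measurableSet_le measurable_const htime).inter (measurableSet_lt htime measurable_snd)
  exact hflow.indicator hset

lemma lintegral_beforeSwitch (hcont : Continuous lam) (hnonneg : ∀ x, 0 ≤ lam x)
    (hfin : ∀ x, Tendsto (survival a lam x) atTop (nhds 0)) (f : State → ℝ≥0∞) (t : ℝ)
    (y : State) :
    ∫⁻ s, beforeSwitch a f t y s ∂(waitKernel a lam y) = killedFlow a lam f t y := by
  by_cases ht : 0 ≤ t
  · have hind : beforeSwitch a f t y = (Set.Ioi t).indicator fun _ => f (flow a y t) := by
      funext s
      simp only [beforeSwitch, Set.indicator, Set.mem_Ico, Set.mem_Ioi, ht, true_and]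
    rw [hind, lintegral_indicator_const measurableSet_Ioi, waitKernel_Ioi hcont hnonneg hfin y ht,
      killedFlow, if_pos ht, mul_comm]
  · simp [beforeSwitch, killedFlow, Set.indicator, ht]

namespace IsZigZag

variable {Ω : Type*} [MeasurableSpace Ω] {Q : Measure Ω} [IsProbabilityMeasure Q]
  {Z : ℕ → Ω → ℝ} {x : State}

lemma aemeasurable_path (hcont : Continuous lam) (hZ : IsZigZag a lam x Q Z) {t : ℝ}
    (ht : 0 ≤ t) : AEMeasurable (fun ω => path a x (fun k => Z k ω) t) Q := by
  have hT (n : ℕ) : Measurable fun ω => switchTime (fun k => Z k ω) n :=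
    (hZ.measurable_switchState n).fst
  let A (n : ℕ) : Set Ω :=
    {ω | switchTime (fun k => Z k ω) n ≤ t ∧ t < switchTime (fun k => Z k ω) (n + 1)}
  have hA (n : ℕ) : MeasurableSet (A n) :=
    (measurableSet_le (hT n) measurable_const).inter
      (measurableSet_lt measurable_const (hT (n + 1)))
  have hcover : Q.restrict (⋃ n, A n) = Q := by
    refine Measure.restrict_eq_self_of_ae_mem ?_
    filter_upwards [hZ.tendsto_switchTime hcont] with ω hω
    exact Set.mem_iUnion.2 (exists_switchTime_le_lt hω ht)
  rw [← hcover, aemeasurable_iUnion_iff]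
  refine fun n => ⟨fun ω => flow a (skeleton a x (fun k => Z k ω) n)
    (t - switchTime (fun k => Z k ω) n), ?_, ?_⟩
  · exact measurable_flow.comp ((hZ.measurable_switchState n).snd.prodMk ((hT n).const_sub t))
  · rw [EventuallyEq, ae_restrict_iff' (hA n)]
    filter_upwards [hZ.ae_pos] with ω hω hn
    exact path_eq_flow (fun k => (hω k).le) x hn.1 hn.2

lemma lintegral_dysonTerm (hcont : Continuous lam) (hnonneg : ∀ x, 0 ≤ lam x)
    (hfin : ∀ x, Tendsto (survival a lam x) atTop (nhds 0)) (hZ : IsZigZag a lam x Q Z)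
    {f : State → ℝ≥0∞} (hf : Measurable f) (t : ℝ) (n m : ℕ) :
    ∫⁻ ω, dysonTerm a lam m f (t - switchTime (fun k => Z k ω) n)
      (skeleton a x (fun k => Z k ω) n) ∂Q = dysonTerm a lam (n + m) f t x := by
  have := isMarkovKernel_waitKernel hcont hnonneg hfin
  induction n generalizing m with
  | zero => simp [switchTime, skeleton]
  | succ n ih =>
    have hmarkov := lintegral_of_hasCondDistrib
      (hZ.hasCondDistrib_switchState hcont hnonneg hfin n)
      (H := fun p => dysonTerm a lam m f (t - (p.1.1 + p.2)) (reverse (flow a p.1.2 p.2)))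
      (by fun_prop)
    simp only [switchTime_succ]
    refine hmarkov.trans ?_
    rw [add_right_comm, add_assoc, ← ih (m + 1)]
    refine lintegral_congr fun ω => ?_
    rw [dysonTerm_succ hnonneg, Kernel.prodMkLeft_apply, lintegral_waitKernel hcont _ (by fun_prop)]
    simp only [sub_sub, switchState]

lemma lintegral_path (hcont : Continuous lam) (hnonneg : ∀ x, 0 ≤ lam x)
    (hfin : ∀ x, Tendsto (survival a lam x) atTop (nhds 0)) (hZ : IsZigZag a lam x Q Z)
    {f : State → ℝ≥0∞} (hf : Measurable f) {t : ℝ} (ht : 0 ≤ t) :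
    ∫⁻ ω, f (path a x (fun k => Z k ω) t) ∂Q = ∑' n, dysonTerm a lam n f t x := by
  have := isMarkovKernel_waitKernel hcont hnonneg hfin
  have hH := measurable_beforeSwitch (a := a) hf t
  calc ∫⁻ ω, f (path a x (fun k => Z k ω) t) ∂Q
      = ∫⁻ ω, ∑' n, beforeSwitch a f (t - switchTime (fun k => Z k ω) n)
          (skeleton a x (fun k => Z k ω) n) (Z n ω) ∂Q := by
        refine lintegral_congr_ae ?_
        filter_upwards [hZ.ae_pos, hZ.tendsto_switchTime hcont] with ω hpos hT
        exact apply_path_eq_tsum_beforeSwitch (fun k => (hpos k).le) hT x f ht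
    _ = ∑' n, ∫⁻ ω, beforeSwitch a f (t - switchTime (fun k => Z k ω) n)
          (skeleton a x (fun k => Z k ω) n) (Z n ω) ∂Q :=
        lintegral_tsum fun n => (hH.comp
          ((hZ.measurable_switchState n).prodMk (hZ.measurable n))).aemeasurable
    _ = ∑' n, ∫⁻ ω, dysonTerm a lam 0 f (t - switchTime (fun k => Z k ω) n)
          (skeleton a x (fun k => Z k ω) n) ∂Q := by
        refine tsum_congr fun n => (lintegral_of_hasCondDistrib
          (hZ.hasCondDistrib_switchState hcont hnonneg hfin n) hH).trans ?_
        exact lintegral_congr fun ω => lintegral_beforeSwitch hcont hnonneg hfin f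
          (t - switchTime (fun k => Z k ω) n) (skeleton a x (fun k => Z k ω) n)
    _ = ∑' n, dysonTerm a lam n f t x :=
        tsum_congr fun n => hZ.lintegral_dysonTerm hcont hnonneg hfin hf t n 0

end IsZigZag

lemma isSkewAdjoint_tsum_dysonTerm (ha : a ≠ 0) (hcont : Continuous lam)
    (hnonneg : ∀ x, 0 ≤ lam x) (t : ℝ) :
    IsSkewAdjoint (invMeasure a lam) (fun f x => ∑' n, dysonTerm a lam n f t x)
      (fun f x => ∑' n, dysonTerm a lam n f t x) := by
  have hmeas (f : State → ℝ≥0∞) (hf : Measurable f) :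
      Measurable fun p : State × ℕ => dysonTerm a lam p.2 f t p.1 :=
    measurable_from_prod_countable_left fun n => by
      dsimp only
      fun_prop
  simpa only [lintegral_count] using IsSkewAdjoint.lintegral (ν := Measure.count)
    (isSkewAdjoint_dysonTerm ha hcont hnonneg · t) hmeas hmeas

lemma invariant_of_isSkewAdjoint {μ : Measure State} {κ : Kernel State State} [IsMarkovKernel κ]
    (h : IsSkewAdjoint μ (fun f x => ∫⁻ y, f y ∂κ x) (fun f x => ∫⁻ y, f y ∂κ x)) :
    κ.Invariant μ := by
  refine Measure.ext fun B hB => ?_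
  have hone := h (f := B.indicator 1) (g := 1) (measurable_one.indicator hB) measurable_one
  simpa [Measure.bind_apply hB κ.measurable.aemeasurable, lintegral_indicator_one hB] using hone

lemma IsZigZag.lintegral_map_path {Ω : Type*} [MeasurableSpace Ω] {Q : Measure Ω}
    [IsProbabilityMeasure Q] {Z : ℕ → Ω → ℝ} {x : State} (hcont : Continuous lam)
    (hnonneg : ∀ x, 0 ≤ lam x) (hfin : ∀ x, Tendsto (survival a lam x) atTop (nhds 0))
    (hZ : IsZigZag a lam x Q Z) (t : ℝ≥0) {f : State → ℝ≥0∞} (hf : Measurable f) :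
    ∫⁻ y, f y ∂Q.map (fun ω => path a x (fun k => Z k ω) t) = ∑' n, dysonTerm a lam n f t x :=
  (lintegral_map' hf.aemeasurable (hZ.aemeasurable_path hcont t.coe_nonneg)).trans
    (hZ.lintegral_path hcont hnonneg hfin hf t.coe_nonneg)

theorem exists_isTransitionFunction (hcont : Continuous lam) (hnonneg : ∀ x, 0 ≤ lam x)
    (hfin : ∀ x, Tendsto (survival a lam x) atTop (nhds 0)) :
    ∃ P : ℝ≥0 → Kernel State State, IsTransitionFunction.{u} a lam P ∧
      ∀ (t : ℝ≥0) (x : State) (f : State → ℝ≥0∞), Measurable f →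
        ∫⁻ y, f y ∂P t x = ∑' n, dysonTerm a lam n f t x := by
  choose Ω mΩ Q Z hQ hZ using fun x => exists_isZigZag (a := a) hcont hnonneg hfin x
  have hlaw (t : ℝ≥0) (x : State) (f : State → ℝ≥0∞) (hf : Measurable f) :=
    (hZ x).lintegral_map_path hcont hnonneg hfin t hf
  have hmeas (t : ℝ≥0) :
      Measurable fun x => (Q x).map fun ω => path a x (fun k => Z x k ω) t := by
    refine Measure.measurable_of_measurable_coe _ fun B hB => ?_
    have hB1 : Measurable (B.indicator (1 : State → ℝ≥0∞)) := measurable_one.indicator hB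
    simp only [← lintegral_indicator_one hB, hlaw t _ _ hB1]
    exact Measurable.tsum fun n => by fun_prop
  refine ⟨fun t => ⟨_, hmeas t⟩, ⟨fun t => ⟨fun x => ?_⟩,
    fun x => ⟨Ω x, mΩ x, Q x, Z x, hQ x, hZ x⟩,
    fun x Ω' _ Q' _ Z' hZ' => hZ'.tendsto_switchTime hcont,
    fun x Ω' _ Q' _ Z' hZ' t => Measure.ext_of_lintegral _ fun f hf => ?_⟩, hlaw⟩
  · exact Measure.isProbabilityMeasure_map ((hZ x).aemeasurable_path hcont t.coe_nonneg)
  · exact (hZ'.lintegral_map_path hcont hnonneg hfin t hf).trans (hlaw t x f hf).symm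

theorem mainTheorem6_general (ha : a ≠ 0) (hcont : Continuous lam) (hnonneg : ∀ x, 0 ≤ lam x)
    (hfin : ∀ x, Tendsto (survival a lam x) atTop (nhds 0)) :
    (∀ y : ℝ, IntervalIntegrable (fun η : ℝ => lam (η, 1) - lam (η, -1)) volume 0 y) ∧
    ∃ P : ℝ≥0 → Kernel State State,
      IsTransitionFunction.{u} a lam P ∧ ∀ t : ℝ≥0, (P t).Invariant (invMeasure a lam) := by
  obtain ⟨P, hP, hlaw⟩ := exists_isTransitionFunction.{u} hcont hnonneg hfin
  refine ⟨fun y => (continuous_rate_sub hcont).intervalIntegrable 0 y, P, hP, fun t => ?_⟩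
  have := hP.markov t
  refine invariant_of_isSkewAdjoint fun f g hf hg => ?_
  simp only [hlaw t _ _ hf, hlaw t _ _ (hg.comp measurable_reverse)]
  exact isSkewAdjoint_tsum_dysonTerm ha hcont hnonneg t hf hg

end

end ZigZag

theorem mainTheorem6 (a : ℝ) (ha : 0 < a) (lam : ZigZag.State → ℝ)
    (hcont : Continuous lam) (hnonneg : ∀ x, 0 ≤ lam x)
    (hlam : ZigZag.RateAssumption lam) :
    (∀ y : ℝ, IntervalIntegrable (fun η : ℝ => lam (η, 1) - lam (η, -1)) volume 0 y) ∧
    BddBelow (Set.range (ZigZag.potential a lam)) ∧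
    ∃ P : ℝ≥0 → Kernel ZigZag.State ZigZag.State,
      ZigZag.IsTransitionFunction.{u} a lam P ∧
      ∀ t : ℝ≥0, (P t).Invariant (ZigZag.invMeasure a lam) := by
  obtain ⟨y₀, lmin, -, hmin, hlow, hle⟩ := hlam
  have hfin := ZigZag.tendsto_survival_of_le_rate ha hcont hmin hlow
  obtain ⟨hint, hP⟩ := ZigZag.mainTheorem6_general.{u} ha.ne' hcont hnonneg hfin
  exact ⟨hint, ZigZag.bddBelow_range_potential ha hcont hle, hP⟩
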